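/- Let $H^2$ be the Hardy space of the unit disk $\mathbb{D}$, identified through boundary values with a closed subspace of $L^2(\partial\mathbb{D})$ (normalized arc length, with inner product $\langle\cdot,\cdot\rangle$). For a finite Blaschke product $\alpha$ let $K_\alpha=H^2\ominus\alpha H^2$, let $P_\alpha$ be the orthogonal projection of $L^2(\partial\mathbb{D})$ onto $K_\alpha$, and let $$k_0^\alpha(z)=1-\overline{\alpha(0)}\,\alpha(z),\qquad \widetilde{k}_0^\alpha(z)=\frac{\alpha(z)-\alpha(0)}{z},$$ both of which belong to $K_\alpha$. Write $(f\otimes g)(h)=\langle h,g\rangle f$. The compressed shift is $S_\alpha f=P_\alpha(zf)$, $f\in K_\alpha$, and for $c\in\mathbb{C}$ the modified compressed shift is $S_{\alpha,c}=S_\alpha+c\,(k_0^\alpha\otimes\widetilde{k}_0^\alpha)$. For finite Blaschke products $\alpha,\beta$ let $\mathscr{T}(\alpha,\beta)$ be the set of asymmetric truncated Toeplitz operators, that is, of all bounded operators $A_\varphi^{\alpha,\beta}\colon K_\alpha\to K_\beta$, $A_\varphi^{\alpha,\beta}f=P_\beta(\varphi f)$, with $\varphi\in L^2(\partial\mathbb{D})$.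 Theorem. Let $\alpha,\beta$ be finite Blaschke products and let $a,b\in\mathbb{C}$. A linear operator $A\colon K_\alpha\to K_\beta$ belongs to $\mathscr{T}(\alpha,\beta)$ if and only if there are functions $\chi\in K_\alpha$ and $\psi\in K_\beta$ such that $$A-S_{\beta,b}\,A\,S_{\alpha,a}^{*}=\psi\otimes k_0^\alpha+k_0^\beta\otimes\chi .$$ -/

import Mathlib

open MeasureTheory AddCircle
open scoped ComplexConjugate ENNReal

noncomputable section

/-- The Lebesgue space `L²(∂𝔻)` with respect to normalized arc length. The circle is parametrized
by `t ↦ exp (2 π i t)`, `t ∈ ℝ/ℤ`. -/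
abbrev L2Circle : Type := Lp ℂ 2 (haarAddCircle (T := 1))

/-- The Hardy space `H²`, identified via boundary values with the subspace of `L²(∂𝔻)` of
functions all of whose Fourier coefficients of negative index vanish. -/
def hardySpace : Submodule ℂ L2Circle where
  carrier := {f | ∀ n : ℤ, n < 0 → fourierCoeff f n = 0}
  zero_mem' := by
    intro n _
    rw [← fourierBasis_repr]; simp
  add_mem' := by
    intro f g hf hg n hn
    have h1 := hf n hn
    have h2 := hg n hn
    rw [← fourierBasis_repr] at h1 h2 ⊢
    simp [h1, h2]
  smul_mem' := by
    intro c f hf n hn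
    have h1 := hf n hn
    rw [← fourierBasis_repr] at h1 ⊢
    simp [h1]

theorem mem_hardySpace_iff (f : L2Circle) :
    f ∈ hardySpace ↔ ∀ n : ℤ, n < 0 → fourierCoeff f n = 0 := Iff.rfl

theorem fourierCoeff_eq_inner (f : L2Circle) (n : ℤ) :
    fourierCoeff f n = inner ℂ (fourierLp (T := 1) 2 n) f := by
  rw [← fourierBasis_repr, HilbertBasis.repr_apply_apply, coe_fourierBasis]

theorem isClosed_hardySpace : IsClosed (hardySpace : Set L2Circle) := by
  have : (hardySpace : Set L2Circle) =
      ⋂ n : ℤ, ⋂ _ : n < 0, {f : L2Circle | inner ℂ (fourierLp (T := 1) 2 n) f = 0} := by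
    ext f
    simp [mem_hardySpace_iff, fourierCoeff_eq_inner]
  rw [this]
  exact isClosed_iInter fun n => isClosed_iInter fun _ =>
    isClosed_eq (continuous_const.inner continuous_id) continuous_const

/-- Multiplication by a continuous function on `L²(∂𝔻)`. -/
def mulOp (g : C(AddCircle (1 : ℝ), ℂ)) : L2Circle →L[ℂ] L2Circle :=
  (ContinuousLinearMap.mul ℂ ℂ).holderL haarAddCircle ∞ 2 2
    (ContinuousMap.toLp ∞ haarAddCircle ℂ g)

theorem coeFn_mulOp (g : C(AddCircle (1 : ℝ), ℂ)) (f : L2Circle) :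
    mulOp g f =ᵐ[haarAddCircle] fun t => g t * f t := by
  have h1 := (ContinuousLinearMap.mul ℂ ℂ).coeFn_holder (r := 2)
    (ContinuousMap.toLp ∞ haarAddCircle ℂ g) f
  have h2 := ContinuousMap.coeFn_toLp (p := ∞) (𝕜 := ℂ) haarAddCircle g
  refine Filter.EventuallyEq.trans h1 ?_
  filter_upwards [h2] with t ht
  rw [ContinuousLinearMap.mul_apply', ht]

theorem continuous_coe_toCircle : Continuous fun t : AddCircle (1 : ℝ) => (toCircle t : ℂ) :=
  (fourier (T := 1) 1).continuous.congr fun _ => fourier_one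

theorem fourierCoeff_boundary {F : ℂ → ℂ} (hF : ∀ z, ‖z‖ ≤ 1 → DifferentiableAt ℂ F z) (k : ℕ) :
    fourierCoeff (fun t : AddCircle (1 : ℝ) => F (toCircle t)) (-(k : ℤ)) = 0 ^ k * F 0 := by
  have hd : DiffContOnCl ℂ (fun z => z ^ k * F z) (Metric.ball 0 |1|) := by
    refine DifferentiableOn.diffContOnCl fun z hz => ?_
    have hz' : ‖z‖ ≤ 1 := by
      rw [abs_one, closure_ball _ one_ne_zero] at hz
      simpa using hz
    exact ((differentiableAt_id.pow k).mul (hF z hz')).differentiableWithinAt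
  rw [← hd.circleAverage, fourierCoeff_eq_intervalIntegral _ _ 0, Real.circleAverage]
  have h := intervalIntegral.smul_integral_comp_mul_left (a := 0) (b := 1)
    (fun θ => circleMap 0 1 θ ^ k * F (circleMap 0 1 θ)) (2 * Real.pi)
  rw [mul_zero, mul_one] at h
  rw [← h, smul_smul, inv_mul_cancel₀ Real.two_pi_pos.ne']
  simp only [div_one, zero_add]
  congr 1
  refine intervalIntegral.integral_congr fun x _ => ?_
  have hx : (toCircle (x : AddCircle (1 : ℝ)) : ℂ) = circleMap 0 1 (2 * Real.pi * x) := by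
    simp [toCircle_apply_mk, circleMap]
  simp only [neg_neg, smul_eq_mul]
  rw [fourier_apply, toCircle_zsmul, Circle.coe_zpow, hx, zpow_natCast]

theorem toLp_mem_hardySpace {g : C(AddCircle (1 : ℝ), ℂ)}
    (hg : ∀ k : ℕ, 0 < k → fourierCoeff g (-(k : ℤ)) = 0) :
    ContinuousMap.toLp 2 haarAddCircle ℂ g ∈ hardySpace := by
  intro n hn
  rw [fourierCoeff_toLp]
  obtain ⟨k, hk⟩ := Int.eq_ofNat_of_zero_le (neg_nonneg.mpr hn.le)
  rw [show n = -(k : ℤ) by omega]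
  exact hg k (by omega)

theorem toLp_inner_mulOp {g u : C(AddCircle (1 : ℝ), ℂ)} {G : ℂ → ℂ}
    (hG : ∀ z, ‖z‖ ≤ 1 → DifferentiableAt ℂ G z) (hG0 : G 0 = 0)
    (hgu : ∀ t, conj (g t) * u t = G (toCircle t)) {f : L2Circle} (hf : f ∈ hardySpace) :
    inner ℂ (ContinuousMap.toLp 2 haarAddCircle ℂ g) (mulOp u f) = 0 := by
  have h1 : inner ℂ (ContinuousMap.toLp 2 haarAddCircle ℂ g) (mulOp u f) =
      inner ℂ (ContinuousMap.toLp 2 haarAddCircle ℂ (g * star u)) f := by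
    rw [L2.inner_def, L2.inner_def]
    refine integral_congr_ae ?_
    filter_upwards [coeFn_mulOp u f, ContinuousMap.coeFn_toLp (p := 2) (𝕜 := ℂ) haarAddCircle g,
      ContinuousMap.coeFn_toLp (p := 2) (𝕜 := ℂ) haarAddCircle (g * star u)] with t h2 h3 h4
    rw [h2, h3, h4]
    simp
    ring
  rw [h1, ← fourierBasis.tsum_inner_mul_inner]
  refine (tsum_congr fun j => ?_).trans tsum_zero
  rw [coe_fourierBasis, ← fourierCoeff_eq_inner]
  rcases lt_or_ge j 0 with hj | hj
  · rw [hf j hj, mul_zero]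
  · obtain ⟨k, rfl⟩ := Int.eq_ofNat_of_zero_le hj
    have h2 := fourierCoeff_boundary hG k
    rw [hG0, mul_zero] at h2
    convert zero_mul _ using 2
    rw [← h2, L2.inner_def, fourierCoeff]
    refine integral_congr_ae ?_
    filter_upwards [ContinuousMap.coeFn_toLp (p := 2) (𝕜 := ℂ) haarAddCircle (g * star u),
      coeFn_fourierLp (T := 1) 2 (k : ℤ)] with t h3 h4
    rw [h3, h4, ← hgu]
    simp

/-- A finite Blaschke product
`α(z) = c ∏ⱼ (z - aⱼ) / (1 - conj aⱼ z)`, `|c| = 1`, `|aⱼ| < 1`. -/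
structure FiniteBlaschkeProduct where
  degree : ℕ
  const : ℂ
  norm_const : ‖const‖ = 1
  zero : Fin degree → ℂ
  norm_zero_lt : ∀ j, ‖zero j‖ < 1

namespace FiniteBlaschkeProduct

variable (α β : FiniteBlaschkeProduct)

/-- The value `α(z)`, for `z` in the closed unit disk. -/
def eval (z : ℂ) : ℂ :=
  α.const * ∏ j, (z - α.zero j) / (1 - conj (α.zero j) * z)

theorem denom_ne_zero {z : ℂ} (hz : ‖z‖ ≤ 1) (j : Fin α.degree) :
    1 - conj (α.zero j) * z ≠ 0 := by
  intro h
  have h1 : ‖conj (α.zero j) * z‖ = 1 := by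
    rw [← sub_eq_zero.mp h]; simp
  rw [norm_mul, RCLike.norm_conj] at h1
  have := α.norm_zero_lt j
  nlinarith [norm_nonneg z, norm_nonneg (α.zero j)]

theorem differentiableAt_eval {z : ℂ} (hz : ‖z‖ ≤ 1) : DifferentiableAt ℂ α.eval z := by
  unfold eval
  refine (DifferentiableAt.fun_finsetProd fun j _ => ?_).const_mul _
  exact (by fun_prop : DifferentiableAt ℂ (fun z => z - α.zero j) z).div (by fun_prop)
    (α.denom_ne_zero hz j)

theorem norm_eval {z : ℂ} (hz : ‖z‖ = 1) : ‖α.eval z‖ = 1 := by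
  have key : ∀ j, ‖(z - α.zero j) / (1 - conj (α.zero j) * z)‖ = 1 := by
    intro j
    have h0 := α.denom_ne_zero hz.le j
    rw [norm_div, div_eq_one_iff_eq (norm_ne_zero_iff.mpr h0)]
    have hzz : conj z * z = 1 := by
      rw [Complex.conj_mul', hz]; simp
    have : 1 - conj (α.zero j) * z = conj (z - α.zero j) * z := by
      rw [map_sub, sub_mul, hzz]
    rw [this, norm_mul, RCLike.norm_conj, hz, mul_one]
  rw [eval, norm_mul, α.norm_const, norm_prod, Finset.prod_congr rfl fun j _ => key j]
  simp

/-- The boundary function of `α` on the unit circle. -/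
def boundary : C(AddCircle (1 : ℝ), ℂ) where
  toFun t := α.eval (toCircle t)
  continuous_toFun := by
    rw [continuous_iff_continuousAt]
    intro t
    exact ContinuousAt.comp (g := α.eval) (f := fun t : AddCircle (1 : ℝ) => (toCircle t : ℂ))
      (α.differentiableAt_eval (Circle.norm_coe _).le).continuousAt continuous_coe_toCircle.continuousAt

theorem boundary_apply (t : AddCircle (1 : ℝ)) : α.boundary t = α.eval (toCircle t) := rfl

/-- The model space `K_α = H² ⊖ α H²`. -/
def modelSpace : Submodule ℂ L2Circle :=
  hardySpace ⊓ (hardySpace.map (mulOp α.boundary : L2Circle →ₗ[ℂ] L2Circle))ᗮ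

instance : CompleteSpace α.modelSpace :=
  (isClosed_hardySpace.inter (Submodule.isClosed_orthogonal _)).completeSpace_coe

theorem toLp_mem_modelSpace {g : C(AddCircle (1 : ℝ), ℂ)} {G : ℂ → ℂ}
    (hg : ∀ k : ℕ, 0 < k → fourierCoeff g (-(k : ℤ)) = 0)
    (hG : ∀ z, ‖z‖ ≤ 1 → DifferentiableAt ℂ G z) (hG0 : G 0 = 0)
    (hgu : ∀ t, conj (g t) * α.boundary t = G (toCircle t)) :
    ContinuousMap.toLp 2 haarAddCircle ℂ g ∈ α.modelSpace := by
  refine Submodule.mem_inf.mpr ⟨toLp_mem_hardySpace hg, ?_⟩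
  rw [Submodule.mem_orthogonal']
  rintro _ ⟨f, hf, rfl⟩
  exact toLp_inner_mulOp hG hG0 hgu hf

theorem conj_boundary_mul (t : AddCircle (1 : ℝ)) :
    conj (α.boundary t) * α.boundary t = 1 := by
  rw [Complex.conj_mul', boundary_apply, α.norm_eval (Circle.norm_coe _)]
  simp

theorem conj_toCircle_mul (t : AddCircle (1 : ℝ)) :
    conj (toCircle t : ℂ) * toCircle t = 1 := by
  rw [Complex.conj_mul', Circle.norm_coe]
  simp

/-- The boundary values of `k₀^α(z) = 1 - conj (α(0)) α(z)`. -/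
def kernelFun : C(AddCircle (1 : ℝ), ℂ) where
  toFun t := 1 - conj (α.eval 0) * α.eval (toCircle t)
  continuous_toFun := continuous_const.sub (continuous_const.mul α.boundary.continuous)

/-- The boundary values of the conjugate kernel `(α(z) - α(0)) / z`. -/
def conjKernelFun : C(AddCircle (1 : ℝ), ℂ) where
  toFun t := (α.eval (toCircle t) - α.eval 0) / toCircle t
  continuous_toFun := (α.boundary.continuous.sub continuous_const).div
    continuous_coe_toCircle fun _ => Circle.coe_ne_zero _

theorem kernelFun_apply (t : AddCircle (1 : ℝ)) :
    α.kernelFun t = 1 - conj (α.eval 0) * α.eval (toCircle t) := rfl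

theorem conjKernelFun_apply (t : AddCircle (1 : ℝ)) :
    α.conjKernelFun t = (α.eval (toCircle t) - α.eval 0) / toCircle t := rfl

/-- The kernel function `k₀^α`, as an element of `K_α`. -/
def kernel : α.modelSpace :=
  ⟨ContinuousMap.toLp 2 haarAddCircle ℂ α.kernelFun, by
    refine α.toLp_mem_modelSpace (G := fun z => α.eval z - α.eval 0) ?_ ?_ ?_ ?_
    · intro k hk
      have h := fourierCoeff_boundary (F := fun z => 1 - conj (α.eval 0) * α.eval z)
        (fun z hz => (differentiableAt_const _).sub ((α.differentiableAt_eval hz).const_mul _)) k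
      rwa [zero_pow hk.ne', zero_mul] at h
    · exact fun z hz => (α.differentiableAt_eval hz).sub_const _
    · simp
    · intro t
      have h := α.conj_boundary_mul t
      simp only [boundary_apply, kernelFun_apply, map_sub, map_one, map_mul,
        Complex.conj_conj] at h ⊢
      linear_combination (-α.eval 0) * h⟩

/-- The conjugate kernel function of `K_α` at `0`, as an element of `K_α`. -/
def conjKernel : α.modelSpace :=
  ⟨ContinuousMap.toLp 2 haarAddCircle ℂ α.conjKernelFun, by
    refine α.toLp_mem_modelSpace (G := fun z => z * (1 - conj (α.eval 0) * α.eval z)) ?_ ?_ ?_ ?_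
    · intro k hk
      have h := fourierCoeff_boundary (F := fun z => α.eval z - α.eval 0)
        (fun z hz => (α.differentiableAt_eval hz).sub_const _) (k - 1)
      rw [sub_self, mul_zero] at h
      rw [← h, fourierCoeff, fourierCoeff]
      refine integral_congr_ae (Filter.Eventually.of_forall fun t => ?_)
      have hk' : -(-(k : ℤ)) = -(-((k - 1 : ℕ) : ℤ)) + 1 := by omega
      have ht : (toCircle t : ℂ) ≠ 0 := Circle.coe_ne_zero _
      simp only [hk', fourier_add, fourier_one, conjKernelFun_apply, smul_eq_mul]
      field_simp
    · exact fun z hz => differentiableAt_id.mul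
        ((differentiableAt_const _).sub ((α.differentiableAt_eval hz).const_mul _))
    · simp
    · intro t
      have h := α.conj_boundary_mul t
      have h' := conj_toCircle_mul t
      have hz : conj (toCircle t : ℂ) ≠ 0 := left_ne_zero_of_mul (h' ▸ one_ne_zero)
      simp only [boundary_apply, conjKernelFun_apply, map_sub, map_div₀] at h ⊢
      rw [div_mul_eq_mul_div, div_eq_iff hz]
      linear_combination h -
        (1 - conj (α.eval 0) * α.eval (toCircle t)) * h'⟩

/-- The compressed shift `S_α f = P_α (z f)` on `K_α`. -/
def compressedShift : α.modelSpace →L[ℂ] α.modelSpace :=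
  α.modelSpace.orthogonalProjectionOnto ∘L mulOp (fourier 1) ∘L α.modelSpace.subtypeL

/-- The modified compressed shift `S_{α,c} = S_α + c (k₀^α ⊗ k̃₀^α)`, where
`(f ⊗ g) h = ⟨h, g⟩ f` is `InnerProductSpace.rankOne ℂ f g`. -/
def modifiedShift (c : ℂ) : α.modelSpace →L[ℂ] α.modelSpace :=
  α.compressedShift + c • InnerProductSpace.rankOne ℂ α.kernel α.conjKernel

/-- The set `𝒯(α, β)` of asymmetric truncated Toeplitz operators: the bounded operators
`f ↦ P_β (φ f)`, `f ∈ K_α`, with symbol `φ ∈ L²(∂𝔻)`. -/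
def asymTruncToeplitz : Set (α.modelSpace →ₗ[ℂ] β.modelSpace) :=
  {A | Continuous A ∧ ∃ φ : L2Circle, ∀ f : α.modelSpace,
    ∃ h : MemLp (fun t => φ t * (f : L2Circle) t) 2 haarAddCircle,
      A f = β.modelSpace.orthogonalProjectionOnto (h.toLp _)}

end FiniteBlaschkeProduct

end

open MeasureTheory AddCircle
open scoped ComplexConjugate ENNReal

noncomputable section

/-! The proof studies the displacement `A - S_β A S_α^*`, first for `a = b = 0`. On `K_α` the
adjoint `S_α^*` is the backward shift `f ↦ z̄ f - ⟨f, k₀^α⟩ z̄`, and `P_β (z u) = S_β P_β u + û(-1)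
k₀^β`. Multiplication by `φ` commutes with multiplication by `z`, so only the two correction terms
survive in the displacement of a Toeplitz operator, and they have the required form
(`toeplitz_sub_apply`).

Conversely, given `χ` and `ψ`, the symbol `ψ + conj χ` has exactly the prescribed displacement
(`toeplitz_add_star_sub_apply`). The displacement determines the operator: `B = S_β B S_α^*`
iterates to `B = S_β^n B S_α^{*n}`, where `S_β` is a contraction and `S_α^{*n} → 0` strongly
(`eq_zero_of_displacement_eq_zero`).

Passing to general `a`, `b` changes the displacement by a term of the same form
(`exists_modifiedShift_sub`), absorbed into `χ` and `ψ`. Elements of `K_α` are continuous and `K_α`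
is finite-dimensional, so every symbol in `L²` gives a bounded operator. -/

/-! ### Multiplication operators and Fourier modes on the circle -/

theorem mulOp_toLp (g h : C(AddCircle (1 : ℝ), ℂ)) :
    mulOp g (ContinuousMap.toLp 2 haarAddCircle ℂ h) =
      ContinuousMap.toLp 2 haarAddCircle ℂ (g * h) := by
  refine Lp.ext ?_
  filter_upwards [coeFn_mulOp g (ContinuousMap.toLp 2 haarAddCircle ℂ h),
    ContinuousMap.coeFn_toLp (p := 2) (𝕜 := ℂ) haarAddCircle h,
    ContinuousMap.coeFn_toLp (p := 2) (𝕜 := ℂ) haarAddCircle (g * h)] with t h1 h2 h3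
  rw [h1, h2, h3, ContinuousMap.mul_apply]

theorem mulOp_mulOp (g h : C(AddCircle (1 : ℝ), ℂ)) (f : L2Circle) :
    mulOp g (mulOp h f) = mulOp (g * h) f := by
  refine Lp.ext ?_
  filter_upwards [coeFn_mulOp g (mulOp h f), coeFn_mulOp h f, coeFn_mulOp (g * h) f]
    with t h1 h2 h3
  rw [h1, h2, h3, ContinuousMap.mul_apply, mul_assoc]

theorem mulOp_one (f : L2Circle) : mulOp 1 f = f := by
  refine Lp.ext ?_
  filter_upwards [coeFn_mulOp 1 f] with t h1
  rw [h1, ContinuousMap.one_apply, one_mul]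

theorem inner_mulOp_left (g : C(AddCircle (1 : ℝ), ℂ)) (u v : L2Circle) :
    inner ℂ (mulOp g u) v = inner ℂ u (mulOp (star g) v) := by
  rw [L2.inner_def, L2.inner_def]
  refine integral_congr_ae ?_
  filter_upwards [coeFn_mulOp g u, coeFn_mulOp (star g) v] with t h1 h2
  rw [h1, h2]
  simp
  ring

theorem inner_mulOp_right (g : C(AddCircle (1 : ℝ), ℂ)) (u v : L2Circle) :
    inner ℂ u (mulOp g v) = inner ℂ (mulOp (star g) u) v := by
  rw [inner_mulOp_left, star_star]

theorem star_fourier (n : ℤ) : star (fourier (T := (1 : ℝ)) n) = fourier (-n) := by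
  ext t
  simp

theorem fourier_mul_fourier (m n : ℤ) :
    fourier (T := (1 : ℝ)) m * fourier n = fourier (m + n) := by
  ext t
  simp

theorem fourier_zero_eq_one : fourier (T := (1 : ℝ)) 0 = 1 := by
  ext t
  simp

theorem mulOp_fourierLp (g : C(AddCircle (1 : ℝ), ℂ)) (n : ℤ) :
    mulOp g (fourierLp (T := 1) 2 n) = ContinuousMap.toLp 2 haarAddCircle ℂ (g * fourier n) :=
  mulOp_toLp g (fourier n)

theorem mulOp_fourier_fourierLp (m n : ℤ) :
    mulOp (fourier m) (fourierLp (T := 1) 2 n) = fourierLp (T := 1) 2 (m + n) := by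
  rw [mulOp_fourierLp, fourier_mul_fourier]

theorem inner_fourierLp (m n : ℤ) :
    inner ℂ (fourierLp (T := 1) 2 m) (fourierLp (T := 1) 2 n) = if m = n then (1 : ℂ) else 0 :=
  orthonormal_iff_ite.mp orthonormal_fourier m n

theorem inner_fourierLp_mulOp_fourier (m n : ℤ) (f : L2Circle) :
    inner ℂ (fourierLp (T := 1) 2 n) (mulOp (fourier m) f) =
      inner ℂ (fourierLp (T := 1) 2 (n - m)) f := by
  rw [inner_mulOp_right, star_fourier, mulOp_fourier_fourierLp, neg_add_eq_sub]

/-! ### The Hardy space and conjugation -/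

theorem mem_hardySpace_iff_inner (f : L2Circle) :
    f ∈ hardySpace ↔ ∀ n : ℤ, n < 0 → inner ℂ (fourierLp (T := 1) 2 n) f = 0 := by
  simp only [mem_hardySpace_iff, fourierCoeff_eq_inner]

/-- Multiplication by a function holomorphic on the closed disk preserves `H²`. -/
theorem mulOp_mem_hardySpace {u : C(AddCircle (1 : ℝ), ℂ)} {F : ℂ → ℂ}
    (hF : ∀ z, ‖z‖ ≤ 1 → DifferentiableAt ℂ F z) (hu : ∀ t, u t = F (toCircle t))
    {f : L2Circle} (hf : f ∈ hardySpace) : mulOp u f ∈ hardySpace := by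
  rw [mem_hardySpace_iff_inner]
  intro n hn
  obtain ⟨k, hk⟩ := Int.eq_ofNat_of_zero_le (neg_nonneg.mpr hn.le)
  have hk0 : k ≠ 0 := by omega
  -- With `n = -k`, the conjugate of `z ^ n` is `z ^ k`; since `k > 0`, `z ^ k * F z` vanishes at
  -- the origin.
  refine toLp_inner_mulOp (g := fourier n) (G := fun z => z ^ k * F z)
    (fun z hz => (differentiableAt_id.pow k).mul (hF z hz)) (by simp [hk0]) (fun t => ?_) hf
  rw [← fourier_neg, hk, hu, fourier_apply, toCircle_zsmul, Circle.coe_zpow, zpow_natCast]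

theorem fourierLp_mem_hardySpace {n : ℤ} (hn : 0 ≤ n) : fourierLp (T := 1) 2 n ∈ hardySpace := by
  rw [mem_hardySpace_iff_inner]
  intro m hm
  rw [inner_fourierLp, if_neg (by omega)]

theorem mulOp_fourier_one_mem_hardySpace {f : L2Circle} (hf : f ∈ hardySpace) :
    mulOp (fourier 1) f ∈ hardySpace :=
  mulOp_mem_hardySpace (F := fun z => z) (fun _ _ => differentiableAt_id)
    (fun _ => fourier_one) hf

theorem coeFn_fourierLp' (n : ℤ) :
    (fourierLp (T := 1) 2 n : AddCircle (1 : ℝ) → ℂ) =ᵐ[haarAddCircle] fourier n :=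
  coeFn_fourierLp 2 n

theorem inner_fourierLp_star (n : ℤ) (f : L2Circle) :
    inner ℂ (fourierLp (T := 1) 2 n) (star f) =
      conj (inner ℂ (fourierLp (T := 1) 2 (-n)) f) := by
  rw [L2.inner_def, L2.inner_def, ← integral_conj]
  refine integral_congr_ae ?_
  filter_upwards [coeFn_fourierLp' n, coeFn_fourierLp' (-n), Lp.coeFn_star f] with t h1 h2 h3
  rw [h1, h2, h3]
  simp

/-- Only the constant terms contribute to the pairing of `H²` with the conjugate of `H²`. -/
theorem inner_star_of_mem_hardySpace {f g : L2Circle} (hf : f ∈ hardySpace)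
    (hg : g ∈ hardySpace) :
    inner ℂ g (star f) =
      inner ℂ g (fourierLp (T := 1) 2 0) * conj (inner ℂ (fourierLp (T := 1) 2 0) f) := by
  rw [mem_hardySpace_iff_inner] at hf hg
  rw [← fourierBasis.tsum_inner_mul_inner g (star f), tsum_eq_single 0]
  · rw [coe_fourierBasis, inner_fourierLp_star, neg_zero]
  · intro n hn
    rw [coe_fourierBasis, inner_fourierLp_star]
    -- A negative index kills the coefficient of `g`, a positive one that of `f` at `-n`.
    rcases lt_or_gt_of_ne hn with h | h
    · rw [← inner_conj_symm, hg n h, map_zero, zero_mul]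
    · rw [hf (-n) (by omega), map_zero, mul_zero]

theorem star_add_star (u v : L2Circle) : star (u + star v) = star u + v := by
  refine Lp.ext ?_
  filter_upwards [Lp.coeFn_star (u + star v), Lp.coeFn_add u (star v), Lp.coeFn_star v,
    Lp.coeFn_star u, Lp.coeFn_add (star u) v] with t h1 h2 h3 h4 h5
  rw [h1, h5, Pi.star_apply, h2, Pi.add_apply, h3, Pi.add_apply, h4]
  simp

theorem norm_mulOp_fourier (n : ℤ) (f : L2Circle) : ‖mulOp (fourier n) f‖ = ‖f‖ := by
  have h : inner ℂ (mulOp (fourier n) f) (mulOp (fourier n) f) = inner ℂ f f := by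
    rw [inner_mulOp_left, mulOp_mulOp, star_fourier, fourier_mul_fourier, neg_add_cancel,
      fourier_zero_eq_one, mulOp_one]
  rw [inner_self_eq_norm_sq_to_K, inner_self_eq_norm_sq_to_K] at h
  have h' : ‖mulOp (fourier n) f‖ ^ 2 = ‖f‖ ^ 2 := by exact_mod_cast h
  exact (sq_eq_sq₀ (norm_nonneg _) (norm_nonneg _)).mp h'

namespace FiniteBlaschkeProduct

variable (α β : FiniteBlaschkeProduct)

/-! ### Membership in the model space -/

theorem inner_mulOp_boundary (f : α.modelSpace) {h : L2Circle} (hh : h ∈ hardySpace) :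
    inner ℂ (mulOp α.boundary h) (f : L2Circle) = 0 :=
  (Submodule.mem_orthogonal _ _).mp f.2.2 _ ⟨h, hh, rfl⟩

theorem mem_modelSpace_iff (f : L2Circle) :
    f ∈ α.modelSpace ↔ f ∈ hardySpace ∧
      ∀ h ∈ hardySpace, inner ℂ (mulOp α.boundary h) f = 0 := by
  rw [modelSpace, Submodule.mem_inf, Submodule.mem_orthogonal]
  refine and_congr_right fun _ => ⟨fun H h hh => H _ ⟨h, hh, rfl⟩, ?_⟩
  rintro H _ ⟨h, hh, rfl⟩
  exact H h hh

theorem mulOp_boundary_mem_hardySpace {h : L2Circle} (hh : h ∈ hardySpace) :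
    mulOp α.boundary h ∈ hardySpace :=
  mulOp_mem_hardySpace (fun _ hz => α.differentiableAt_eval hz) α.boundary_apply hh

/-! ### Finite dimension and continuity of the elements of the model space -/

/-- The denominator `∏ⱼ (1 - conj aⱼ z)` on the unit circle. -/
def denomFun : C(AddCircle (1 : ℝ), ℂ) where
  toFun t := ∏ j, (1 - conj (α.zero j) * toCircle t)
  continuous_toFun := continuous_finsetProd _ fun _ _ =>
    continuous_const.sub (continuous_const.mul continuous_coe_toCircle)

theorem denomFun_apply (t : AddCircle (1 : ℝ)) :
    α.denomFun t = ∏ j, (1 - conj (α.zero j) * toCircle t) := rfl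

theorem denomFun_ne_zero (t : AddCircle (1 : ℝ)) : α.denomFun t ≠ 0 := by
  rw [denomFun_apply]
  exact Finset.prod_ne_zero_iff.mpr fun j _ => α.denom_ne_zero (Circle.norm_coe _).le j

/-- The reciprocal of the denominator on the unit circle. -/
def invDenomFun : C(AddCircle (1 : ℝ), ℂ) where
  toFun t := (α.denomFun t)⁻¹
  continuous_toFun := α.denomFun.continuous.inv₀ α.denomFun_ne_zero

theorem invDenomFun_mul : α.invDenomFun * α.denomFun = 1 := by
  ext t
  exact inv_mul_cancel₀ (α.denomFun_ne_zero t)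

theorem mulOp_denomFun_mem_hardySpace {h : L2Circle} (hh : h ∈ hardySpace) :
    mulOp α.denomFun h ∈ hardySpace :=
  mulOp_mem_hardySpace (F := fun z => ∏ j, (1 - conj (α.zero j) * z))
    (fun _ _ => by fun_prop) α.denomFun_apply hh

/-- On the circle, `z ^ n` times the conjugate of the denominator is, up to the unimodular
constant, the numerator of `α`. -/
theorem star_denomFun_mul_fourier :
    star α.denomFun * fourier (α.degree : ℤ) = conj α.const • (α.boundary * α.denomFun) := by
  ext t
  have hc : conj α.const * α.const = 1 := by
    rw [Complex.conj_mul', α.norm_const]; simp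
  -- On `|z| = 1`, `conj (1 - āz) z = z - a`; the right side is kept as Blaschke factor times
  -- denominator to match `eval`.
  have hfac : ∀ j, conj (1 - conj (α.zero j) * (toCircle t : ℂ)) * toCircle t =
      (toCircle t - α.zero j) / (1 - conj (α.zero j) * toCircle t) *
        (1 - conj (α.zero j) * toCircle t) := by
    intro j
    rw [div_mul_cancel₀ _ (α.denom_ne_zero (Circle.norm_coe _).le j)]
    simp only [map_sub, map_one, map_mul, Complex.conj_conj]
    linear_combination (-α.zero j) * conj_toCircle_mul t
  have hprod := Finset.prod_congr (rfl : (Finset.univ : Finset (Fin α.degree)) = _)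
    fun j _ => hfac j
  simp only [Finset.prod_mul_distrib, Finset.prod_const, Finset.card_univ, Fintype.card_fin]
    at hprod
  simp only [ContinuousMap.mul_apply, ContinuousMap.star_apply, ContinuousMap.smul_apply,
    smul_eq_mul, denomFun_apply, boundary_apply, eval]
  rw [fourier_apply, toCircle_zsmul, Circle.coe_zpow, zpow_natCast, Complex.star_def, map_prod,
    hprod]
  linear_combination (-((∏ j, (toCircle t - α.zero j) / (1 - conj (α.zero j) * toCircle t)) *
    ∏ j, (1 - conj (α.zero j) * (toCircle t : ℂ)))) * hc

/-- For `n ≥ deg α`, moving the denominator across the inner product turns `z ^ n` into a multiple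
of `α` times the denominator times `z ^ (n - deg α)`, an element of `α H²`. -/
theorem inner_fourierLp_mulOp_denomFun (f : α.modelSpace) {n : ℤ} (hn : (α.degree : ℤ) ≤ n) :
    inner ℂ (fourierLp (T := 1) 2 n) (mulOp α.denomFun (f : L2Circle)) = 0 := by
  have h1 : star α.denomFun * fourier n =
      α.boundary * (conj α.const • (α.denomFun * fourier (n - α.degree))) := by
    have h2 : fourier (T := (1 : ℝ)) n = fourier (α.degree : ℤ) * fourier (n - α.degree) := by
      rw [fourier_mul_fourier, add_sub_cancel]
    rw [h2, ← mul_assoc, star_denomFun_mul_fourier, smul_mul_assoc, mul_smul_comm, mul_assoc]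
  rw [inner_mulOp_right, mulOp_fourierLp, h1, ← mulOp_toLp, map_smul, ← mulOp_fourierLp]
  exact α.inner_mulOp_boundary f (hardySpace.smul_mem _
    (α.mulOp_denomFun_mem_hardySpace (fourierLp_mem_hardySpace (by omega))))

/-- Every element of `K_α` is a polynomial of degree less than `deg α` divided by the
denominator of `α`. -/
theorem modelSpace_le_span : α.modelSpace ≤ Submodule.span ℂ (Set.range fun k : Fin α.degree =>
    ContinuousMap.toLp 2 haarAddCircle ℂ (α.invDenomFun * fourier (k : ℤ))) := by
  intro f hf
  -- The product of `f` with the denominator has Fourier support in `0 ≤ n < deg α`, so its Fourier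
  -- series is a polynomial.
  have h1 : mulOp α.denomFun f = ∑ k ∈ (Finset.univ : Finset (Fin α.degree)).image
      (fun k : Fin α.degree => ((k : ℕ) : ℤ)), inner ℂ (fourierLp (T := 1) 2 k) (mulOp α.denomFun f) •
        fourierLp (T := 1) 2 k := by
    have h2 := fourierBasis.hasSum_repr (mulOp α.denomFun f)
    refine h2.unique ?_
    simp only [fourierBasis.repr_apply_apply, coe_fourierBasis]
    refine hasSum_sum_of_ne_finset_zero fun n hn => ?_
    rcases lt_or_ge n 0 with h | h
    · rw [(mem_hardySpace_iff_inner _).mp (α.mulOp_denomFun_mem_hardySpace hf.1) n h, zero_smul]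
    · rw [α.inner_fourierLp_mulOp_denomFun ⟨f, hf⟩, zero_smul]
      by_contra hlt
      refine hn (Finset.mem_image.mpr ⟨⟨n.toNat, by omega⟩, Finset.mem_univ _, ?_⟩)
      simp [h]
  have h3 : f = mulOp α.invDenomFun (mulOp α.denomFun f) := by
    rw [mulOp_mulOp, invDenomFun_mul, mulOp_one]
  rw [h3, h1, map_sum]
  refine Submodule.sum_mem _ fun n hn => ?_
  obtain ⟨k, -, rfl⟩ := Finset.mem_image.mp hn
  rw [map_smul, mulOp_fourierLp]
  exact Submodule.smul_mem _ _ (Submodule.subset_span ⟨k, rfl⟩)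

instance : FiniteDimensional ℂ α.modelSpace := by
  have : FiniteDimensional ℂ (Submodule.span ℂ (Set.range fun k : Fin α.degree =>
      ContinuousMap.toLp 2 haarAddCircle ℂ (α.invDenomFun * fourier (k : ℤ)))) :=
    FiniteDimensional.span_of_finite ℂ (Set.finite_range _)
  exact Submodule.finiteDimensional_of_le α.modelSpace_le_span

theorem exists_toLp_eq (f : α.modelSpace) :
    ∃ g : C(AddCircle (1 : ℝ), ℂ), ContinuousMap.toLp 2 haarAddCircle ℂ g = (f : L2Circle) := by
  have h : Submodule.span ℂ (Set.range fun k : Fin α.degree =>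
      ContinuousMap.toLp 2 haarAddCircle ℂ (α.invDenomFun * fourier (k : ℤ))) ≤
      LinearMap.range (ContinuousMap.toLp 2 haarAddCircle ℂ :
        C(AddCircle (1 : ℝ), ℂ) →L[ℂ] L2Circle).toLinearMap := by
    rw [Submodule.span_le]
    rintro _ ⟨k, rfl⟩
    exact ⟨_, rfl⟩
  exact h (α.modelSpace_le_span f.2)

/-- A product of two `L²` functions is in general only `L¹`; the continuous representative of `f` is
what keeps it in `L²`. -/
theorem memLp_mul (φ : L2Circle) (f : α.modelSpace) :
    MemLp (fun t => φ t * (f : L2Circle) t) 2 haarAddCircle := by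
  obtain ⟨g, hg⟩ := α.exists_toLp_eq f
  refine (memLp_congr_ae ?_).mp (Lp.memLp (mulOp g φ))
  filter_upwards [coeFn_mulOp g φ, ContinuousMap.coeFn_toLp (p := 2) (𝕜 := ℂ) haarAddCircle g]
    with t h1 h2
  rw [h1, ← hg, h2, mul_comm]

/-! ### The kernel at the origin and the adjoint of the compressed shift -/

theorem coe_kernel : (α.kernel : L2Circle) =
    fourierLp (T := 1) 2 0 - conj (α.eval 0) • mulOp α.boundary (fourierLp (T := 1) 2 0) := by
  rw [mulOp_fourierLp]
  change ContinuousMap.toLp 2 haarAddCircle ℂ α.kernelFun =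
    ContinuousMap.toLp 2 haarAddCircle ℂ (fourier 0) - _
  rw [← map_smul, ← map_sub]
  congr 1
  ext t
  simp [kernelFun_apply, boundary_apply]

/-- The kernel function `k₀^α` reproduces the value at the origin. -/
theorem inner_kernel (f : α.modelSpace) :
    inner ℂ α.kernel f = inner ℂ (fourierLp (T := 1) 2 0) (f : L2Circle) := by
  rw [Submodule.coe_inner, coe_kernel, inner_sub_left, inner_smul_left,
    α.inner_mulOp_boundary f (fourierLp_mem_hardySpace le_rfl), mul_zero, sub_zero]

/-- The adjoint of the compressed shift is the backward shift. -/
theorem coe_adjoint_compressedShift (f : α.modelSpace) :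
    (ContinuousLinearMap.adjoint α.compressedShift f : L2Circle) =
      mulOp (fourier (-1)) (f : L2Circle) -
        inner ℂ α.kernel f • fourierLp (T := 1) 2 (-1) := by
  have hmem : mulOp (fourier (-1)) (f : L2Circle) -
      inner ℂ α.kernel f • fourierLp (T := 1) 2 (-1) ∈ α.modelSpace := by
    rw [mem_modelSpace_iff, mem_hardySpace_iff_inner]
    refine ⟨fun n hn => ?_, fun h hh => ?_⟩
    · rw [inner_sub_right, inner_smul_right, inner_fourierLp_mulOp_fourier, inner_fourierLp,
        sub_neg_eq_add, inner_kernel]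
      -- At `n = -1` the constant term of `f`, shifted down, cancels against the subtracted mode.
      rcases eq_or_ne n (-1) with rfl | hn'
      · simp
      · rw [(mem_hardySpace_iff_inner _).mp f.2.1 _ (by omega), if_neg hn', mul_zero, sub_zero]
    -- `αh` has no coefficient at `-1`, and `⟨αh, z̄f⟩` becomes the pairing of `f` with `α(zh)`,
    -- which vanishes.
    · have h1 := (mem_hardySpace_iff_inner _).mp (α.mulOp_boundary_mem_hardySpace hh) (-1)
        (by norm_num)
      rw [inner_sub_right, inner_smul_right, ← inner_conj_symm _ (fourierLp 2 (-1)), h1,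
        inner_mulOp_right, star_fourier, neg_neg, mulOp_mulOp, mul_comm, ← mulOp_mulOp,
        α.inner_mulOp_boundary f (mulOp_fourier_one_mem_hardySpace hh)]
      simp
  refine congrArg Subtype.val
    (a₁ := ContinuousLinearMap.adjoint α.compressedShift f) (a₂ := ⟨_, hmem⟩) ?_
  refine ext_inner_left ℂ fun g => ?_
  rw [ContinuousLinearMap.adjoint_inner_right, compressedShift]
  simp only [ContinuousLinearMap.comp_apply, Submodule.subtypeL_apply,
    Submodule.inner_orthogonalProjectionOnto_eq_of_mem_right]
  rw [Submodule.coe_inner, inner_mulOp_left, star_fourier, inner_sub_right, inner_smul_right,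
    ← inner_conj_symm _ (fourierLp 2 (-1)),
    (mem_hardySpace_iff_inner _).mp g.2.1 (-1) (by norm_num)]
  simp

/-- `P_α (z u) = S_α P_α u + û(-1) k₀^α` for `u ∈ L²`. -/
theorem orthogonalProjectionOnto_mulOp_fourier_one (u : L2Circle) :
    α.modelSpace.orthogonalProjectionOnto (mulOp (fourier 1) u) =
      α.compressedShift (α.modelSpace.orthogonalProjectionOnto u) +
        inner ℂ (fourierLp (T := 1) 2 (-1)) u • α.kernel := by
  -- Dual to the backward shift formula: `z̄ g = S_α^* g + ⟨g, k₀^α⟩ z̄`, paired with `u`.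
  refine ext_inner_left ℂ fun g => ?_
  rw [inner_add_right, inner_smul_right,
    ← ContinuousLinearMap.adjoint_inner_left α.compressedShift,
    Submodule.inner_orthogonalProjectionOnto_eq_of_mem_left,
    Submodule.inner_orthogonalProjectionOnto_eq_of_mem_left, coe_adjoint_compressedShift,
    inner_sub_left, inner_smul_left, inner_conj_symm g α.kernel, inner_mulOp_right, star_fourier]
  ring

/-! ### Toeplitz operators and their displacement -/

/-- The map `f ↦ φ f` from `K_α` to `L²`, for a symbol `φ ∈ L²`. -/
def symbolMul (φ : L2Circle) : α.modelSpace →ₗ[ℂ] L2Circle where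
  toFun f := (α.memLp_mul φ f).toLp _
  map_add' f g := by
    refine Lp.ext ?_
    filter_upwards [(α.memLp_mul φ (f + g)).coeFn_toLp, (α.memLp_mul φ f).coeFn_toLp,
      (α.memLp_mul φ g).coeFn_toLp, Lp.coeFn_add (f : L2Circle) g,
      Lp.coeFn_add ((α.memLp_mul φ f).toLp _) ((α.memLp_mul φ g).toLp _)] with t h1 h2 h3 h4 h5
    rw [h1, h5, Pi.add_apply, h2, h3, Submodule.coe_add, h4, Pi.add_apply, mul_add]
  map_smul' c f := by
    refine Lp.ext ?_
    filter_upwards [(α.memLp_mul φ (c • f)).coeFn_toLp, (α.memLp_mul φ f).coeFn_toLp,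
      Lp.coeFn_smul c (f : L2Circle), Lp.coeFn_smul c ((α.memLp_mul φ f).toLp _)]
      with t h1 h2 h3 h4
    rw [h1, RingHom.id_apply, h4, Pi.smul_apply, h2, Submodule.coe_smul, h3, Pi.smul_apply,
      smul_eq_mul, smul_eq_mul, mul_left_comm]

theorem coeFn_symbolMul (φ : L2Circle) (f : α.modelSpace) :
    α.symbolMul φ f =ᵐ[haarAddCircle] fun t => φ t * (f : L2Circle) t :=
  (α.memLp_mul φ f).coeFn_toLp

/-- The asymmetric truncated Toeplitz operator with symbol `φ`. -/
def toeplitz (φ : L2Circle) : α.modelSpace →ₗ[ℂ] β.modelSpace :=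
  (β.modelSpace.orthogonalProjectionOnto : L2Circle →ₗ[ℂ] β.modelSpace) ∘ₗ α.symbolMul φ

theorem toeplitz_apply (φ : L2Circle) (f : α.modelSpace) :
    toeplitz α β φ f = β.modelSpace.orthogonalProjectionOnto (α.symbolMul φ f) := rfl

/-- Boundedness and square integrability of `φ f` are automatic here, so only the symbol remains. -/
theorem mem_asymTruncToeplitz_iff (A : α.modelSpace →ₗ[ℂ] β.modelSpace) :
    A ∈ asymTruncToeplitz α β ↔ ∃ φ, A = toeplitz α β φ := by
  constructor
  · rintro ⟨-, φ, h⟩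
    refine ⟨φ, LinearMap.ext fun f => ?_⟩
    obtain ⟨hφ, hf⟩ := h f
    exact hf
  · rintro ⟨φ, rfl⟩
    exact ⟨LinearMap.continuous_of_finiteDimensional _, φ, fun f => ⟨α.memLp_mul φ f, rfl⟩⟩

theorem symbolMul_adjoint_compressedShift (φ : L2Circle) (f : α.modelSpace) :
    α.symbolMul φ (ContinuousLinearMap.adjoint α.compressedShift f) =
      mulOp (fourier (-1)) (α.symbolMul φ f) -
        inner ℂ α.kernel f • mulOp (fourier (-1)) φ := by
  have h0 := α.coeFn_symbolMul φ (ContinuousLinearMap.adjoint α.compressedShift f)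
  rw [coe_adjoint_compressedShift] at h0
  refine Lp.ext ?_
  filter_upwards [h0, α.coeFn_symbolMul φ f,
    coeFn_mulOp (fourier (-1)) (α.symbolMul φ f), coeFn_mulOp (fourier (-1)) φ,
    coeFn_mulOp (fourier (-1)) f, coeFn_fourierLp' (-1),
    Lp.coeFn_sub (mulOp (fourier (-1)) (α.symbolMul φ f))
      (inner ℂ α.kernel f • mulOp (fourier (-1)) φ),
    Lp.coeFn_smul (inner ℂ α.kernel f) (mulOp (fourier (-1)) φ),
    Lp.coeFn_sub (mulOp (fourier (-1)) (f : L2Circle))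
      (inner ℂ α.kernel f • fourierLp (T := 1) 2 (-1)),
    Lp.coeFn_smul (inner ℂ α.kernel f) (fourierLp (T := 1) 2 (-1))]
    with t h1 h2 h3 h4 h5 h6 h7 h8 h9 h10
  rw [h1, h7, Pi.sub_apply, h3, h8, Pi.smul_apply, h4, h2, h9, Pi.sub_apply, h5, h10,
    Pi.smul_apply, h6, smul_eq_mul, smul_eq_mul]
  ring

/-- The mean of `φ f` is the pairing of `f` with `conj φ`; its representative in `K_α` supplies `χ`.
-/
theorem inner_fourierLp_zero_symbolMul (φ : L2Circle) (f : α.modelSpace) :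
    inner ℂ (fourierLp (T := 1) 2 0) (α.symbolMul φ f) =
      inner ℂ (α.modelSpace.orthogonalProjectionOnto (star φ)) f := by
  rw [Submodule.inner_orthogonalProjectionOnto_eq_of_mem_right, L2.inner_def, L2.inner_def]
  refine integral_congr_ae ?_
  filter_upwards [coeFn_fourierLp' 0, α.coeFn_symbolMul φ f, Lp.coeFn_star φ] with t h1 h2 h3
  rw [h1, h2, h3]
  simp [mul_comm]

/-- The displacement `A - S_β A S_α^*` of a truncated Toeplitz operator with symbol `φ`. -/
theorem toeplitz_sub_apply (φ : L2Circle) (f : α.modelSpace) :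
    toeplitz α β φ f - β.compressedShift
        (toeplitz α β φ (ContinuousLinearMap.adjoint α.compressedShift f)) =
      inner ℂ α.kernel f • (β.modelSpace.orthogonalProjectionOnto φ -
          inner ℂ (fourierLp (T := 1) 2 0) φ • β.kernel) +
        inner ℂ (α.modelSpace.orthogonalProjectionOnto (star φ)) f • β.kernel := by
  -- Apply the shift formula to `z̄ u`: its coefficient at `-1` is the mean of `u`.
  have key : ∀ u : L2Circle, β.compressedShift
      (β.modelSpace.orthogonalProjectionOnto (mulOp (fourier (-1)) u)) =
      β.modelSpace.orthogonalProjectionOnto u - inner ℂ (fourierLp (T := 1) 2 0) u • β.kernel := by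
    intro u
    have h := β.orthogonalProjectionOnto_mulOp_fourier_one (mulOp (fourier (-1)) u)
    rw [mulOp_mulOp, fourier_mul_fourier, add_neg_cancel, fourier_zero_eq_one, mulOp_one,
      inner_fourierLp_mulOp_fourier, sub_self] at h
    rw [h, add_sub_cancel_right]
  rw [toeplitz_apply, toeplitz_apply, symbolMul_adjoint_compressedShift, map_sub, map_sub,
    map_smul, map_smul, key, key, inner_fourierLp_zero_symbolMul]
  abel

theorem orthogonalProjectionOnto_star {h : L2Circle} (hh : h ∈ hardySpace) :
    α.modelSpace.orthogonalProjectionOnto (star h) =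
      conj (inner ℂ (fourierLp (T := 1) 2 0) h) • α.kernel := by
  refine ext_inner_left ℂ fun g => ?_
  rw [Submodule.inner_orthogonalProjectionOnto_eq_of_mem_left,
    inner_star_of_mem_hardySpace hh g.2.1, inner_smul_right, ← inner_conj_symm g α.kernel,
    inner_kernel, inner_conj_symm (g : L2Circle), mul_comm]

/-- The displacement of the truncated Toeplitz operator with symbol `ψ + conj χ`. -/
theorem toeplitz_add_star_sub_apply (χ : α.modelSpace) (ψ : β.modelSpace) (f : α.modelSpace) :
    toeplitz α β (ψ + star (χ : L2Circle)) f - β.compressedShift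
        (toeplitz α β (ψ + star (χ : L2Circle))
          (ContinuousLinearMap.adjoint α.compressedShift f)) =
      inner ℂ α.kernel f • ψ + inner ℂ χ f • β.kernel := by
  -- The extra multiples of `k₀^β` coming from the means of `ψ` and `χ` cancel.
  rw [toeplitz_sub_apply, star_add_star, map_add, map_add, β.orthogonalProjectionOnto_star χ.2.1,
    α.orthogonalProjectionOnto_star ψ.2.1, Submodule.orthogonalProjectionOnto_mem_subspace_eq_self,
    Submodule.orthogonalProjectionOnto_mem_subspace_eq_self, inner_add_right,
    inner_fourierLp_star, neg_zero, inner_add_left, inner_smul_left, Complex.conj_conj]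
  module

/-! ### Injectivity of the displacement -/

theorem norm_compressedShift_apply_le (f : α.modelSpace) : ‖α.compressedShift f‖ ≤ ‖f‖ :=
  (α.modelSpace.norm_orthogonalProjectionOnto_apply_le _).trans_eq
    (norm_mulOp_fourier 1 (f : L2Circle))

/-- The backward shift drops leading coefficients; the correction sits at index `-1`, invisible to
`k ≥ 0`. -/
theorem inner_fourierLp_adjoint_iterate (f : α.modelSpace) (n k : ℕ) :
    inner ℂ (fourierLp (T := 1) 2 (k : ℤ))
        (((ContinuousLinearMap.adjoint α.compressedShift)^[n] f : α.modelSpace) : L2Circle) =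
      inner ℂ (fourierLp (T := 1) 2 ((k + n : ℕ) : ℤ)) (f : L2Circle) := by
  induction n generalizing k with
  | zero => rfl
  | succ n ih =>
    rw [Function.iterate_succ_apply', coe_adjoint_compressedShift, inner_sub_right,
      inner_smul_right, inner_fourierLp_mulOp_fourier, inner_fourierLp, if_neg (by omega),
      mul_zero, sub_zero, sub_neg_eq_add, ← Nat.cast_succ, ih]
    congr 3
    omega

theorem hasSum_norm_sq_inner (f : α.modelSpace) :
    HasSum (fun k : ℕ => ‖inner ℂ (fourierLp (T := 1) 2 (k : ℤ)) (f : L2Circle)‖ ^ 2)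
      (‖f‖ ^ 2) := by
  have h : HasSum (fun k : ℤ => ‖inner ℂ (fourierLp (T := 1) 2 k) (f : L2Circle)‖ ^ 2)
      (‖f‖ ^ 2) := by
    have h1 := fourierBasis.hasSum_inner_mul_inner (f : L2Circle) f
    simp only [coe_fourierBasis, inner_self_eq_norm_sq_to_K] at h1
    have h2 := Complex.hasSum_re h1
    convert h2 using 1
    · ext k
      rw [← inner_conj_symm (f : L2Circle), Complex.conj_mul']
      norm_cast
    · norm_cast
  refine (Nat.cast_injective.hasSum_iff fun n hn => ?_).mpr h
  rw [(mem_hardySpace_iff_inner _).mp f.2.1 n, norm_zero, zero_pow two_ne_zero]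
  by_contra hn'
  exact hn ⟨n.toNat, by omega⟩

/-- The powers of the adjoint of the compressed shift tend strongly to zero. -/
theorem tendsto_adjoint_compressedShift_iterate (f : α.modelSpace) :
    Filter.Tendsto (fun n => ‖(ContinuousLinearMap.adjoint α.compressedShift)^[n] f‖)
      Filter.atTop (nhds 0) := by
  -- By Parseval, the squared norm of the `n`-th iterate is the tail from `n` of the coefficient
  -- series of `f`.
  have h := tendsto_sum_nat_add
    fun k : ℕ => ‖inner ℂ (fourierLp (T := 1) 2 (k : ℤ)) (f : L2Circle)‖ ^ 2
  have h' := h.sqrt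
  rw [Real.sqrt_zero] at h'
  refine h'.congr fun n => ?_
  have h2 := α.hasSum_norm_sq_inner ((ContinuousLinearMap.adjoint α.compressedShift)^[n] f)
  simp only [inner_fourierLp_adjoint_iterate] at h2
  rw [h2.tsum_eq, Real.sqrt_sq (norm_nonneg _)]

/-- An operator intertwined by `B = S_β B S_α^*` vanishes. -/
theorem eq_zero_of_displacement_eq_zero (B : α.modelSpace →ₗ[ℂ] β.modelSpace)
    (hB : ∀ f, B f = β.compressedShift (B (ContinuousLinearMap.adjoint α.compressedShift f))) :
    B = 0 := by
  ext1 f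
  obtain ⟨C, hC⟩ : ∃ C, ∀ g, ‖B g‖ ≤ C * ‖g‖ :=
    ⟨_, (LinearMap.toContinuousLinearMap B).le_opNorm⟩
  have h : ∀ n g, ‖B g‖ ≤ ‖B ((ContinuousLinearMap.adjoint α.compressedShift)^[n] g)‖ := by
    intro n
    induction n with
    | zero => exact fun g => le_rfl
    | succ n ih =>
      intro g
      rw [Function.iterate_succ_apply]
      refine le_trans ?_ (ih _)
      rw [hB g]
      exact β.norm_compressedShift_apply_le _
  have hlim := (α.tendsto_adjoint_compressedShift_iterate f).const_mul C
  rw [mul_zero] at hlim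
  exact norm_le_zero_iff.mp (ge_of_tendsto' hlim fun n => (h n f).trans (hC _))

/-- Characterization of truncated Toeplitz operators by their displacement with respect to the
compressed shifts. -/
theorem mem_asymTruncToeplitz_iff_compressedShift (A : α.modelSpace →ₗ[ℂ] β.modelSpace) :
    A ∈ asymTruncToeplitz α β ↔ ∃ (χ : α.modelSpace) (ψ : β.modelSpace), ∀ f,
      A f - β.compressedShift (A (ContinuousLinearMap.adjoint α.compressedShift f)) =
        inner ℂ α.kernel f • ψ + inner ℂ χ f • β.kernel := by
  rw [mem_asymTruncToeplitz_iff]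
  constructor
  · rintro ⟨φ, rfl⟩
    exact ⟨_, _, toeplitz_sub_apply α β φ⟩
  · rintro ⟨χ, ψ, h⟩
    -- The difference between `A` and this Toeplitz operator has zero displacement.
    refine ⟨ψ + star (χ : L2Circle), sub_eq_zero.mp
      (eq_zero_of_displacement_eq_zero α β _ fun f => ?_)⟩
    rw [LinearMap.sub_apply, LinearMap.sub_apply, map_sub, ← sub_eq_zero, sub_sub_sub_comm, h,
      toeplitz_add_star_sub_apply, sub_self]

/-! ### Passage to the modified shifts -/

theorem adjoint_modifiedShift_apply (a : ℂ) (f : α.modelSpace) :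
    ContinuousLinearMap.adjoint (α.modifiedShift a) f =
      ContinuousLinearMap.adjoint α.compressedShift f +
        (conj a * inner ℂ α.kernel f) • α.conjKernel := by
  refine ext_inner_left ℂ fun g => ?_
  rw [ContinuousLinearMap.adjoint_inner_right, inner_add_right,
    ContinuousLinearMap.adjoint_inner_right, modifiedShift, add_apply, smul_apply,
    InnerProductSpace.rankOne_apply, inner_add_left, inner_smul_left (E := α.modelSpace)]
  rw [inner_smul_left, inner_smul_right (E := α.modelSpace), inner_conj_symm g α.conjKernel]
  ring

/-- Changing the parameters of the modified shifts changes the displacement only by operators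
of the form `ψ ⊗ k₀^α + k₀^β ⊗ χ`. -/
theorem exists_modifiedShift_sub (a b : ℂ) (A : α.modelSpace →ₗ[ℂ] β.modelSpace) :
    ∃ (χ : α.modelSpace) (ψ : β.modelSpace), ∀ f,
      β.modifiedShift b (A (ContinuousLinearMap.adjoint (α.modifiedShift a) f)) -
          β.compressedShift (A (ContinuousLinearMap.adjoint α.compressedShift f)) =
        inner ℂ α.kernel f • ψ + inner ℂ χ f • β.kernel := by
  let T : α.modelSpace →L[ℂ] β.modelSpace :=
    LinearMap.toContinuousLinearMap A ∘L ContinuousLinearMap.adjoint (α.modifiedShift a)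
  -- The difference is `S_β (T f - A S_α^* f)` plus `b ⟨T f, k̃₀^β⟩ k₀^β`. The first term is a
  -- multiple of `⟨f, k₀^α⟩`, giving `ψ`; the functional in the second gives `χ`, with `conj b`
  -- because `inner` is conjugate-linear in its first slot.
  refine ⟨conj b • ContinuousLinearMap.adjoint T β.conjKernel,
    β.compressedShift (conj a • A α.conjKernel), fun f => ?_⟩
  have hT : T f = A (ContinuousLinearMap.adjoint (α.modifiedShift a) f) := rfl
  rw [inner_smul_left (E := α.modelSpace), Complex.conj_conj,
    ContinuousLinearMap.adjoint_inner_left, hT, modifiedShift, add_apply, smul_apply,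
    InnerProductSpace.rankOne_apply, smul_smul, add_sub_right_comm, add_left_inj, ← map_sub,
    ← map_sub, adjoint_modifiedShift_apply, add_sub_cancel_left, map_smul, map_smul, map_smul,
    mul_comm, mul_smul]

end FiniteBlaschkeProduct

end

theorem mainTheorem1 (α β : FiniteBlaschkeProduct) (a b : ℂ)
    (A : α.modelSpace →ₗ[ℂ] β.modelSpace) :
    A ∈ FiniteBlaschkeProduct.asymTruncToeplitz α β ↔
      ∃ (χ : α.modelSpace) (ψ : β.modelSpace),
        A - (β.modifiedShift b : β.modelSpace →ₗ[ℂ] β.modelSpace) ∘ₗ A ∘ₗ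
            (ContinuousLinearMap.adjoint (α.modifiedShift a) :
              α.modelSpace →ₗ[ℂ] α.modelSpace) =
          (InnerProductSpace.rankOne ℂ ψ α.kernel : α.modelSpace →ₗ[ℂ] β.modelSpace) +
            (InnerProductSpace.rankOne ℂ β.kernel χ : α.modelSpace →ₗ[ℂ] β.modelSpace) := by
  obtain ⟨χ₀, ψ₀, h₀⟩ := FiniteBlaschkeProduct.exists_modifiedShift_sub α β a b A
  rw [FiniteBlaschkeProduct.mem_asymTruncToeplitz_iff_compressedShift]
  constructor
  · rintro ⟨χ, ψ, h⟩
    refine ⟨χ - χ₀, ψ - ψ₀, LinearMap.ext fun f => ?_⟩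
    change A f - β.modifiedShift b (A (ContinuousLinearMap.adjoint (α.modifiedShift a) f)) =
      inner ℂ α.kernel f • (ψ - ψ₀) + inner ℂ (χ - χ₀) f • β.kernel
    rw [inner_sub_left]
    rw [← sub_sub_sub_cancel_right _ _
      (β.compressedShift (A (ContinuousLinearMap.adjoint α.compressedShift f))), h, h₀]
    module
  · rintro ⟨χ, ψ, h⟩
    refine ⟨χ + χ₀, ψ + ψ₀, fun f => ?_⟩
    have hf : A f - β.modifiedShift b (A (ContinuousLinearMap.adjoint (α.modifiedShift a) f)) =
      inner ℂ α.kernel f • ψ + inner ℂ χ f • β.kernel := LinearMap.congr_fun h f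
    rw [inner_add_left]
    rw [← sub_add_sub_cancel _
      (β.modifiedShift b (A (ContinuousLinearMap.adjoint (α.modifiedShift a) f))), hf, h₀]
    module
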